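/- Let $N\ge 1$, $1<p<\infty$, $0<s<1$, and let $\Omega\subsetneq\mathbb{R}^N$ be an open set. Write $d_\Omega(x)=\operatorname{dist}(x,\partial\Omega)$, $J_p(t)=|t|^{p-2}t$ and, for measurable $E\subset\mathbb{R}^N$, $$[u]^p_{W^{s,p}(E)}=\iint_{E\times E}\frac{|u(x)-u(y)|^p}{|x-y|^{N+sp}}\,dx\,dy .$$ Let $W^{s,p}(E)=\{u\in L^p(E):[u]_{W^{s,p}(E)}<\infty\}$, and let $W^{s,p}_{\rm loc}(\Omega)$ be the space of functions $u\in L^p_{\rm loc}(\Omega)$ with $u\in W^{s,p}(\Omega')$ for every open $\Omega'$ whose closure is a compact subset of $\Omega$. Let $\widetilde W^{s,p}_0(\Omega)$ be the closure of $C^\infty_0(\Omega)$ in $W^{s,p}(\mathbb{R}^N)$ with respect to the norm $\|u\|_{L^p(\mathbb{R}^N)}+[u]_{W^{s,p}(\mathbb{R}^N)}$. Let $L^{p-1}_{sp}(\mathbb{R}^N)$ be the set of $u\in L^{p-1}_{\rm loc}(\mathbb{R}^N)$ with $\int_{\mathbb{R}^N}|u(x)|^{p-1}(1+|x|)^{-N-sp}\,dx<\infty$.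 The sharp fractional Hardy constant of $\Omega$ is $$\mathfrak h_{s,p}(\Omega)=\inf_{\varphi\in C^\infty_0(\Omega)}\left\{[\varphi]^p_{W^{s,p}(\mathbb{R}^N)}:\int_\Omega\frac{|\varphi|^p}{d_\Omega^{sp}}\,dx=1\right\},$$ and it is called attained if there is $v\in\widetilde W^{s,p}_0(\Omega)$ with $\int_\Omega |v|^p d_\Omega^{-sp}\,dx=1$ and $[v]^p_{W^{s,p}(\mathbb{R}^N)}=\mathfrak h_{s,p}(\Omega)$. Suppose that $\partial\Omega$ is locally continuous at some point $x_0\in\partial\Omega$. That is, there exist $\delta_0,\delta_1>0$, an affine isometry $\mathcal O$ of $\mathbb{R}^N$ with $\mathcal O(x_0)=0$, and a continuous function $\Psi:(-\delta_0,\delta_0)^{N-1}\to(-\delta_1,\delta_1)$ such that, with $Q=(-\delta_0,\delta_0)^{N-1}\times(-\delta_1,\delta_1)$, $$Q\cap\mathcal O(\Omega)=\{(x',x_N)\in Q:\Psi(x')<x_N<\delta_1\},\qquad Q\cap\mathcal O(\partial\Omega)=\{(x',x_N)\in Q:x_N=\Psi(x')\}.$$ Suppose further that there is a function $u\in W^{s,p}_{\rm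 loc}(\Omega)\cap L^{p-1}_{sp}(\mathbb{R}^N)$ with $u\ge 0$ almost everywhere in $\mathbb{R}^N$ and $u>0$ almost everywhere in $\Omega$ which is a local weak supersolution of $(-\Delta_p)^su=\lambda\,|u|^{p-2}u/d_\Omega^{sp}$ in $\Omega$ with $\lambda=\mathfrak h_{s,p}(\Omega)$, that is, $$\iint_{\mathbb{R}^N\times\mathbb{R}^N}\frac{J_p(u(x)-u(y))\,(\varphi(x)-\varphi(y))}{|x-y|^{N+sp}}\,dx\,dy\ \ge\ \mathfrak h_{s,p}(\Omega)\int_\Omega\frac{|u|^{p-2}u}{d_\Omega^{sp}}\,\varphi\,dx$$ for every non-negative $\varphi\in W^{s,p}(\mathbb{R}^N)$ with compact support in $\Omega$. Suppose finally that, for some constant $C>0$, $$u\ \ge\ \frac1C\,d_\Omega^{\frac{sp-1}{p}}\qquad\text{almost everywhere in }\Omega .$$ Then $\mathfrak h_{s,p}(\Omega)$ is not attained. -/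

import Mathlib

open MeasureTheory Set
open scoped ENNReal ContDiff

namespace FractionalHardy

noncomputable section

/-- The distance `d_Ω` from the boundary of `Ω`. -/
def bdryDist {N : ℕ} (Ω : Set (EuclideanSpace ℝ (Fin N))) (x : EuclideanSpace ℝ (Fin N)) : ℝ :=
  Metric.infDist x (frontier Ω)

/-- The function `J_p(t) = |t|^{p-2} t`. -/
def Jp (p t : ℝ) : ℝ := |t| ^ (p - 2) * t

/-- The `p`-th power `[u]_{W^{s,p}(E)}^p` of the Gagliardo seminorm on `E`. -/
def gagliardoEnergy {N : ℕ} (s p : ℝ) (E : Set (EuclideanSpace ℝ (Fin N)))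
    (u : EuclideanSpace ℝ (Fin N) → ℝ) : ℝ≥0∞ :=
  ∫⁻ z : EuclideanSpace ℝ (Fin N) × EuclideanSpace ℝ (Fin N) in E ×ˢ E,
    ENNReal.ofReal (|u z.1 - u z.2| ^ p / ‖z.1 - z.2‖ ^ ((N : ℝ) + s * p))

/-- The weighted integral `∫_Ω |u|^p / d_Ω^{sp} dx`. -/
def hardyIntegral {N : ℕ} (s p : ℝ) (Ω : Set (EuclideanSpace ℝ (Fin N)))
    (u : EuclideanSpace ℝ (Fin N) → ℝ) : ℝ≥0∞ :=
  ∫⁻ x in Ω, ENNReal.ofReal (|u x| ^ p / bdryDist Ω x ^ (s * p))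

/-- `u ∈ W^{s,p}(E)`. -/
def MemW {N : ℕ} (s p : ℝ) (E : Set (EuclideanSpace ℝ (Fin N)))
    (u : EuclideanSpace ℝ (Fin N) → ℝ) : Prop :=
  MemLp u (ENNReal.ofReal p) (volume.restrict E) ∧ gagliardoEnergy s p E u < ⊤

/-- `u ∈ W^{s,p}_loc(Ω)`: `u ∈ L^p_loc(Ω)` and `u ∈ W^{s,p}(Ω')` for every open `Ω'` whose closure
is compact and contained in `Ω`. -/
def MemWLoc {N : ℕ} (s p : ℝ) (Ω : Set (EuclideanSpace ℝ (Fin N)))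
    (u : EuclideanSpace ℝ (Fin N) → ℝ) : Prop :=
  (∀ K : Set (EuclideanSpace ℝ (Fin N)), IsCompact K → K ⊆ Ω →
    MemLp u (ENNReal.ofReal p) (volume.restrict K)) ∧
  ∀ Ω' : Set (EuclideanSpace ℝ (Fin N)), IsOpen Ω' → IsCompact (closure Ω') → closure Ω' ⊆ Ω →
    MemW s p Ω' u

/-- `u ∈ L^{p-1}_{sp}(ℝ^N)`: `u ∈ L^{p-1}_loc(ℝ^N)` and
`∫ |u(x)|^{p-1} / (1 + |x|)^{N+sp} dx < ∞`. -/
def MemTail {N : ℕ} (s p : ℝ) (u : EuclideanSpace ℝ (Fin N) → ℝ) : Prop :=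
  AEStronglyMeasurable u volume ∧
  LocallyIntegrable (fun x => |u x| ^ (p - 1)) volume ∧
  Integrable (fun x => |u x| ^ (p - 1) / (1 + ‖x‖) ^ ((N : ℝ) + s * p)) volume

/-- `φ ∈ C^∞_0(Ω)`, extended by zero to the whole space. -/
def IsTest {N : ℕ} (Ω : Set (EuclideanSpace ℝ (Fin N)))
    (φ : EuclideanSpace ℝ (Fin N) → ℝ) : Prop :=
  ContDiff ℝ ∞ φ ∧ HasCompactSupport φ ∧ tsupport φ ⊆ Ω

/-- `u` belongs to the closure of `C^∞_0(Ω)` in `W^{s,p}(ℝ^N)`, with respect to the norm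
`‖u‖_{L^p(ℝ^N)} + [u]_{W^{s,p}(ℝ^N)}`. -/
def MemWTildeZero {N : ℕ} (s p : ℝ) (Ω : Set (EuclideanSpace ℝ (Fin N)))
    (u : EuclideanSpace ℝ (Fin N) → ℝ) : Prop :=
  MemW s p univ u ∧
  ∀ ε : ℝ≥0∞, 0 < ε → ∃ φ : EuclideanSpace ℝ (Fin N) → ℝ, IsTest Ω φ ∧
    eLpNorm (u - φ) (ENNReal.ofReal p) volume + gagliardoEnergy s p univ (u - φ) ^ (1 / p) < ε

/-- The sharp fractional Hardy constant: the infimum of `[u]_{W^{s,p}(ℝ^N)}^p` among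
`u ∈ C^∞_0(Ω)` with `∫_Ω |u|^p / d_Ω^{sp} dx = 1`. -/
def hardyConst {N : ℕ} (s p : ℝ) (Ω : Set (EuclideanSpace ℝ (Fin N))) : ℝ≥0∞ :=
  sInf {e : ℝ≥0∞ | ∃ φ : EuclideanSpace ℝ (Fin N) → ℝ,
    IsTest Ω φ ∧ hardyIntegral s p Ω φ = 1 ∧ e = gagliardoEnergy s p univ φ}

/-- The sharp fractional Hardy constant is attained: there is a minimizer in the closure of
`C^∞_0(Ω)` in `W^{s,p}(ℝ^N)`. -/
def HardyConstAttained {N : ℕ} (s p : ℝ) (Ω : Set (EuclideanSpace ℝ (Fin N))) : Prop :=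
  ∃ v : EuclideanSpace ℝ (Fin N) → ℝ, MemWTildeZero s p Ω v ∧ hardyIntegral s p Ω v = 1 ∧
    gagliardoEnergy s p univ v = hardyConst s p Ω

/-- `u` is a local weak supersolution of `(-Δ_p)^s u = lam |u|^{p-2} u / d_Ω^{sp}` in `Ω`. -/
def IsLocalWeakSupersolution {N : ℕ} (s p : ℝ) (Ω : Set (EuclideanSpace ℝ (Fin N))) (lam : ℝ)
    (u : EuclideanSpace ℝ (Fin N) → ℝ) : Prop :=
  MemWLoc s p Ω u ∧ MemTail s p u ∧
  ∀ φ : EuclideanSpace ℝ (Fin N) → ℝ, MemW s p univ φ → HasCompactSupport φ → tsupport φ ⊆ Ω →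
    (∀ x, 0 ≤ φ x) →
    lam * ∫ x in Ω, Jp p (u x) / bdryDist Ω x ^ (s * p) * φ x ≤
      ∫ z : EuclideanSpace ℝ (Fin N) × EuclideanSpace ℝ (Fin N),
        Jp p (u z.1 - u z.2) * (φ z.1 - φ z.2) / ‖z.1 - z.2‖ ^ ((N : ℝ) + s * p)

/-- The first `n` coordinates `x'` of a point `x = (x', x_N)` of `ℝ^N`, `N = n + 1`. -/
def horiz {n : ℕ} (x : EuclideanSpace ℝ (Fin (n + 1))) : Fin n → ℝ := fun i => x i.castSucc

/-- The last coordinate `x_N` of a point `x = (x', x_N)` of `ℝ^N`, `N = n + 1`. -/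
def vert {n : ℕ} (x : EuclideanSpace ℝ (Fin (n + 1))) : ℝ := x (Fin.last n)

/-- The cube `(-δ, δ)^n`. -/
def openCube (n : ℕ) (δ : ℝ) : Set (Fin n → ℝ) := {y | ∀ i, y i ∈ Ioo (-δ) δ}

/-- The open hyper-rectangle `(-δ₀, δ₀)^{N-1} × (-δ₁, δ₁)`, `N = n + 1`. -/
def hyperRect (n : ℕ) (δ₀ δ₁ : ℝ) : Set (EuclideanSpace ℝ (Fin (n + 1))) :=
  {x | horiz x ∈ openCube n δ₀ ∧ vert x ∈ Ioo (-δ₁) δ₁}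

/-- `∂Ω` is locally continuous at `x₀ ∈ ∂Ω`: after a rigid motion `O` that sends `x₀` to the
origin, near the origin `Ω` is the part above, and `∂Ω` the graph, of a continuous function. -/
def LocallyContinuousBoundaryAt {n : ℕ} (Ω : Set (EuclideanSpace ℝ (Fin (n + 1))))
    (x₀ : EuclideanSpace ℝ (Fin (n + 1))) : Prop :=
  x₀ ∈ frontier Ω ∧
  ∃ (δ₀ δ₁ : ℝ)
    (O : EuclideanSpace ℝ (Fin (n + 1)) ≃ᵃⁱ[ℝ] EuclideanSpace ℝ (Fin (n + 1)))
    (Ψ : (Fin n → ℝ) → ℝ),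
    0 < δ₀ ∧ 0 < δ₁ ∧ O x₀ = 0 ∧
    ContinuousOn Ψ (openCube n δ₀) ∧ MapsTo Ψ (openCube n δ₀) (Ioo (-δ₁) δ₁) ∧
    hyperRect n δ₀ δ₁ ∩ O '' Ω =
      {x | x ∈ hyperRect n δ₀ δ₁ ∧ Ψ (horiz x) < vert x ∧ vert x < δ₁} ∧
    hyperRect n δ₀ δ₁ ∩ O '' frontier Ω =
      {x | x ∈ hyperRect n δ₀ δ₁ ∧ vert x = Ψ (horiz x)}

end

end FractionalHardy

/-! A minimizer is compared with the supersolution through the discrete Picone inequality. Write λ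
for the Hardy constant and d for `bdryDist Ω`. Testing the equation with |φ|^p / (u + ε)^(p-1), for
φ smooth with compact support in Ω, gives λ ∫_Ω (u / (u + ε))^(p-1) |φ|^p / d^(sp) + ∬ R_ε(u, φ) ≤
[φ]^p, where R_ε ≥ 0 is the Picone remainder (`hardy_add_piconeRemainder_le`). Letting φ → v in
W^{s,p} and ε → 0, Fatou's lemma yields λ ∫_Ω |v|^p / d^(sp) + ∬_{Ω×Ω} R_0(u, v) ≤ [v]^p for every v
in the closure (`hardyIntegral_add_piconeRemainder_le`).

If v is a minimizer, the first term and the right side both equal λ, so R_0(u, v) = 0 almost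
everywhere on Ω × Ω. The equality case of Picone, which comes from strict convexity of t^p, then
forces |v| = c u in Ω with c > 0 (`exists_abs_eq_const_mul`).

The lower bound on u now gives |v|^p / d^(sp) ≥ (c/C)^p / d. But ∫_Ω 1/d = ∞: near x₀, d is at most
the vertical distance to the graph, and 1/t is not integrable at 0
(`lintegral_inv_bdryDist_eq_top`). This contradicts ∫_Ω |v|^p / d^(sp) = 1. -/

namespace FractionalHardy

/-! ### Pointwise inequalities: Picone and Lipschitz bounds -/

/-- Convexity of `t ↦ t ^ p` in the form used for Picone's inequality. -/
theorem rpow_add_le_div_add_div {p : ℝ} (hp : 1 < p) {X B t : ℝ} (hX : 0 ≤ X) (hB : 0 ≤ B)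
    (ht0 : 0 < t) (ht1 : t < 1) :
    (X + B) ^ p ≤ X ^ p / (1 - t) ^ (p - 1) + B ^ p / t ^ (p - 1) ∧
      ((X + B) ^ p = X ^ p / (1 - t) ^ (p - 1) + B ^ p / t ^ (p - 1) → X * t = B * (1 - t)) := by
  have h1t : 0 < 1 - t := by linarith
  -- In this form the right side is a convex combination of p-th powers, with weights 1 - t and t at
  -- the points X / (1 - t) and B / t, whose barycentre is X + B.
  have key : ∀ r Y : ℝ, 0 < r → 0 ≤ Y → Y ^ p / r ^ (p - 1) = r * (Y / r) ^ p := by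
    intro r Y hr hY
    rw [Real.div_rpow hY hr.le, Real.rpow_sub hr, Real.rpow_one]
    have := (Real.rpow_pos_of_pos hr p).ne'
    field_simp
  rw [key _ _ h1t hX, key _ _ ht0 hB]
  have hsum : X + B = (1 - t) * (X / (1 - t)) + t * (B / t) := by field_simp
  have hX' : X / (1 - t) ∈ Ici (0 : ℝ) := div_nonneg hX h1t.le
  have hB' : B / t ∈ Ici (0 : ℝ) := div_nonneg hB ht0.le
  have hsc := strictConvexOn_rpow hp
  constructor
  · have := hsc.convexOn.2 hX' hB' h1t.le ht0.le (by ring)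
    simp only [smul_eq_mul] at this
    rwa [← hsum] at this
  · intro heq
    by_contra hne
    have hne' : X / (1 - t) ≠ B / t := by
      intro h
      rw [div_eq_div_iff h1t.ne' ht0.ne'] at h
      exact hne h
    have := hsc.2 hX' hB' hne' h1t ht0 (by ring)
    simp only [smul_eq_mul] at this
    rw [← hsum] at this
    exact this.ne heq

theorem Jp_of_nonneg {p t : ℝ} (hp : 1 < p) (ht : 0 ≤ t) : Jp p t = t ^ (p - 1) := by
  rcases ht.eq_or_lt with rfl | h
  · simp [Jp, Real.zero_rpow (by linarith : p - 1 ≠ 0)]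
  · rw [Jp, abs_of_pos h, ← Real.rpow_add_one h.ne']
    congr 1; ring

theorem Jp_neg (p t : ℝ) : Jp p (-t) = -Jp p t := by simp [Jp]

theorem abs_Jp {p : ℝ} (hp : 1 < p) (t : ℝ) : |Jp p t| = |t| ^ (p - 1) := by
  rw [← Jp_of_nonneg hp (abs_nonneg t)]
  simp [Jp, abs_mul, abs_of_nonneg (Real.rpow_nonneg (abs_nonneg t) _)]

theorem measurable_Jp (p : ℝ) : Measurable (Jp p) := by
  unfold Jp; fun_prop

/-- If A < B, the left side is nonpositive and the right side positive. Otherwise this is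
`rpow_add_le_div_add_div` with X = A - B and t = b / a, for which 1 - t = (a - b) / a. -/
theorem picone_aux {p : ℝ} (hp : 1 < p) {a b A B : ℝ} (hb : 0 < b) (hab : b < a)
    (hA : 0 ≤ A) (hB : 0 ≤ B) :
    Jp p (a - b) * (A ^ p / a ^ (p - 1) - B ^ p / b ^ (p - 1)) ≤ |A - B| ^ p ∧
      (Jp p (a - b) * (A ^ p / a ^ (p - 1) - B ^ p / b ^ (p - 1)) = |A - B| ^ p →
        A * b = B * a) := by
  have ha : 0 < a := hb.trans hab
  have hd : 0 < a - b := sub_pos.2 hab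
  rw [Jp_of_nonneg hp hd.le]
  have hdp : 0 < (a - b) ^ (p - 1) := Real.rpow_pos_of_pos hd _
  have hap : 0 < a ^ (p - 1) := Real.rpow_pos_of_pos ha _
  have hbp : 0 < b ^ (p - 1) := Real.rpow_pos_of_pos hb _
  rcases lt_or_ge A B with h | h
  · have hlt : (a - b) ^ (p - 1) * (A ^ p / a ^ (p - 1) - B ^ p / b ^ (p - 1)) < |A - B| ^ p := by
      have h1 : A ^ p / a ^ (p - 1) ≤ B ^ p / b ^ (p - 1) :=
        div_le_div₀ (Real.rpow_nonneg hB _) (Real.rpow_le_rpow hA h.le (by linarith)) hbp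
          (Real.rpow_le_rpow hb.le hab.le (by linarith))
      have h2 : 0 < |A - B| ^ p := Real.rpow_pos_of_pos (abs_pos.2 (sub_ne_zero.2 h.ne)) _
      nlinarith
    exact ⟨hlt.le, fun heq => absurd heq hlt.ne⟩
  · rw [abs_of_nonneg (sub_nonneg.2 h)]
    have ht0 : 0 < b / a := div_pos hb ha
    have ht1 : b / a < 1 := (div_lt_one ha).2 hab
    obtain ⟨h1, h2⟩ := rpow_add_le_div_add_div hp (sub_nonneg.2 h) hB ht0 ht1
    rw [sub_add_cancel, one_sub_div ha.ne', Real.div_rpow hd.le ha.le,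
      Real.div_rpow hb.le ha.le] at h1 h2
    -- The Picone gap is a positive multiple of the convexity gap, so the inequality and its
    -- equality case both transfer.
    have id1 : (A - B) ^ p - (a - b) ^ (p - 1) * (A ^ p / a ^ (p - 1) - B ^ p / b ^ (p - 1)) =
        (a - b) ^ (p - 1) / a ^ (p - 1) *
          ((A - B) ^ p / ((a - b) ^ (p - 1) / a ^ (p - 1)) + B ^ p / (b ^ (p - 1) / a ^ (p - 1))
            - A ^ p) := by
      field_simp
      ring
    have hc : 0 < (a - b) ^ (p - 1) / a ^ (p - 1) := div_pos hdp hap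
    constructor
    · have := mul_nonneg hc.le (sub_nonneg.2 h1)
      linarith
    · intro heq
      rw [heq, sub_self, eq_comm, mul_eq_zero] at id1
      have := h2 (by linarith [id1.resolve_left hc.ne'])
      field_simp at this
      linarith

/-- Discrete Picone inequality, with its equality case. -/
theorem picone {p : ℝ} (hp : 1 < p) {a b A B : ℝ} (ha : 0 < a) (hb : 0 < b)
    (hA : 0 ≤ A) (hB : 0 ≤ B) :
    Jp p (a - b) * (A ^ p / a ^ (p - 1) - B ^ p / b ^ (p - 1)) ≤ |A - B| ^ p ∧
      (Jp p (a - b) * (A ^ p / a ^ (p - 1) - B ^ p / b ^ (p - 1)) = |A - B| ^ p →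
        A * b = B * a) := by
  rcases lt_trichotomy a b with h | h | h
  · obtain ⟨h1, h2⟩ := picone_aux hp ha h hB hA
    have e : Jp p (a - b) * (A ^ p / a ^ (p - 1) - B ^ p / b ^ (p - 1)) =
        Jp p (b - a) * (B ^ p / b ^ (p - 1) - A ^ p / a ^ (p - 1)) := by
      rw [← neg_sub b a, Jp_neg]; ring
    rw [e, abs_sub_comm]
    exact ⟨h1, fun h => (h2 h).symm⟩
  · subst h
    have : Jp p (a - a) = 0 := by simp [Jp]
    rw [this, zero_mul]
    refine ⟨by positivity, fun h => ?_⟩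
    rw [eq_comm, Real.rpow_eq_zero (abs_nonneg _) (by linarith), abs_eq_zero, sub_eq_zero] at h
    rw [h]
  · exact picone_aux hp hb h hA hB

theorem abs_rpow_sub_rpow_le {p : ℝ} (hp : 1 < p) {M a b : ℝ} (ha : 0 ≤ a) (hb : 0 ≤ b)
    (haM : a ≤ M) (hbM : b ≤ M) : |a ^ p - b ^ p| ≤ p * M ^ (p - 1) * |a - b| := by
  have := (convex_Icc (0 : ℝ) M).norm_image_sub_le_of_norm_hasDerivWithin_le
    (f := fun x => x ^ p) (f' := fun x => p * x ^ (p - 1)) (C := p * M ^ (p - 1))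
    (fun x _ => (Real.hasDerivAt_rpow_const (Or.inr hp.le)).hasDerivWithinAt)
    (fun x hx => ?_) ⟨hb, hbM⟩ ⟨ha, haM⟩
  · simpa only [Real.norm_eq_abs] using this
  · rw [Real.norm_of_nonneg (by have := Real.rpow_nonneg hx.1 (p - 1); nlinarith)]
    gcongr
    · exact hx.1
    · exact hx.2

theorem abs_inv_rpow_sub_inv_rpow_le {q : ℝ} (hq : 0 < q) {ε a b : ℝ} (hε : 0 < ε) (ha : 0 ≤ a)
    (hb : 0 ≤ b) :
    |((a + ε) ^ q)⁻¹ - ((b + ε) ^ q)⁻¹| ≤ q * ε ^ (-q - 1) * |a - b| := by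
  have := (convex_Ici (0 : ℝ)).norm_image_sub_le_of_norm_hasDerivWithin_le
    (f := fun x => (x + ε) ^ (-q)) (f' := fun x => 1 * (-q) * (x + ε) ^ (-q - 1))
    (C := q * ε ^ (-q - 1))
    (fun x hx => (((hasDerivAt_id x).add_const ε).rpow_const
      (Or.inl (by have : 0 ≤ x := hx; positivity))).hasDerivWithinAt)
    (fun x hx => ?_) (mem_Ici.2 hb) (mem_Ici.2 ha)
  · rw [← Real.rpow_neg (by positivity), ← Real.rpow_neg (by positivity)]
    simpa only [Real.norm_eq_abs] using this
  · have hx' : 0 ≤ x := hx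
    rw [one_mul, norm_mul, norm_neg, Real.norm_of_nonneg hq.le,
      Real.norm_of_nonneg (Real.rpow_nonneg (by positivity) _)]
    have := Real.rpow_le_rpow_of_nonpos hε (by linarith : ε ≤ x + ε) (by linarith : -q - 1 ≤ 0)
    gcongr

/-- `(a, b) ↦ |a| ^ p / (b + ε) ^ (p - 1)` is Lipschitz on `[-M, M] × [0, ∞)`. -/
theorem abs_quotient_sub_le {p : ℝ} (hp : 1 < p) {M ε a a' b b' : ℝ} (hε : 0 < ε)
    (ha : |a| ≤ M) (ha' : |a'| ≤ M) (hb : 0 ≤ b) (hb' : 0 ≤ b') :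
    |(|a| ^ p / (b + ε) ^ (p - 1)) - (|a'| ^ p / (b' + ε) ^ (p - 1))| ≤
      (p * M ^ (p - 1) * (ε ^ (p - 1))⁻¹) * |a - a'| +
        (M ^ p * ((p - 1) * ε ^ (-(p - 1) - 1))) * |b - b'| := by
  have hq : 0 < p - 1 := by linarith
  have hM : 0 ≤ M := (abs_nonneg a).trans ha
  have e : |a| ^ p / (b + ε) ^ (p - 1) - |a'| ^ p / (b' + ε) ^ (p - 1) =
      (|a| ^ p - |a'| ^ p) * ((b + ε) ^ (p - 1))⁻¹ +
        |a'| ^ p * (((b + ε) ^ (p - 1))⁻¹ - ((b' + ε) ^ (p - 1))⁻¹) := by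
    rw [div_eq_mul_inv, div_eq_mul_inv]; ring
  rw [e]
  refine (abs_add_le _ _).trans (add_le_add ?_ ?_)
  · rw [abs_mul, abs_of_nonneg (by positivity : 0 ≤ ((b + ε) ^ (p - 1))⁻¹)]
    have h1 := abs_rpow_sub_rpow_le hp (abs_nonneg a) (abs_nonneg a') ha ha'
    have h2 : ((b + ε) ^ (p - 1))⁻¹ ≤ (ε ^ (p - 1))⁻¹ := by
      gcongr; linarith
    have h3 := abs_abs_sub_abs_le_abs_sub a a'
    calc _ ≤ (p * M ^ (p - 1) * |a - a'|) * (ε ^ (p - 1))⁻¹ := by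
          refine mul_le_mul (h1.trans ?_) h2 (by positivity) (by positivity)
          gcongr
      _ = _ := by ring
  · rw [abs_mul, abs_of_nonneg (by positivity : 0 ≤ |a'| ^ p), mul_assoc]
    have := abs_inv_rpow_sub_inv_rpow_le hq hε hb hb'
    gcongr


/-! ### Integrability of the nonlocal forms -/

/-- K keeps a distance δ > 0 from the complement of V, so |x - y| dominates a multiple of 1 + |y|.
The kernel is thereby bounded by the weight appearing in `MemTail`. -/
theorem norm_sub_rpow_inv_le {N : ℕ} {K V : Set (EuclideanSpace ℝ (Fin N))} (hK : IsCompact K)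
    (hV : IsOpen V) (hKV : K ⊆ V) {r : ℝ} (hr : 0 ≤ r) :
    ∃ c : ℝ, 0 ≤ c ∧ ∀ x ∈ K, ∀ y ∉ V, (‖x - y‖ ^ r)⁻¹ ≤ c * (1 + ‖y‖) ^ (-r) := by
  obtain ⟨δ, hδ, hδV⟩ := hK.exists_thickening_subset_open hV hKV
  obtain ⟨R, hR⟩ := hK.isBounded.exists_norm_le
  refine ⟨((1 + |R|) / δ + 1) ^ r, by positivity, fun x hx y hy => ?_⟩
  have hd : δ ≤ ‖x - y‖ := by
    by_contra! h
    refine hy (hδV (Metric.mem_thickening_iff.2 ⟨x, hx, ?_⟩))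
    rwa [dist_comm, dist_eq_norm]
  have hd0 : 0 < ‖x - y‖ := hδ.trans_le hd
  have h1 : ‖y‖ ≤ ‖x‖ + ‖x - y‖ := by
    have := norm_sub_le x (x - y); simpa using this
  have h2 : 1 + ‖y‖ ≤ ((1 + |R|) / δ + 1) * ‖x - y‖ := by
    have h3 : 1 + |R| ≤ (1 + |R|) / δ * ‖x - y‖ := by
      rw [div_mul_eq_mul_div, le_div_iff₀ hδ]
      gcongr
    have := hR x hx
    have := le_abs_self R
    linarith
  rw [Real.rpow_neg (by positivity), inv_le_iff_one_le_mul₀ (by positivity)]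
  calc (1 : ℝ) = (1 + ‖y‖) ^ r * ((1 + ‖y‖) ^ r)⁻¹ := by
        rw [mul_inv_cancel₀ (by positivity)]
    _ ≤ (((1 + |R|) / δ + 1) * ‖x - y‖) ^ r * ((1 + ‖y‖) ^ r)⁻¹ := by gcongr
    _ = _ := by rw [Real.mul_rpow (by positivity) (by positivity)]; ring

/-- The support of F is covered by V × V, K × Vᶜ and Vᶜ × K; by symmetry the third piece mirrors the
second. -/
theorem integrable_of_symmetric {α : Type*} [MeasurableSpace α] {μ : Measure α} [SFinite μ]
    {K V : Set α} (hK : MeasurableSet K) (hV : MeasurableSet V) {F : α × α → ℝ}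
    (hsymm : ∀ z, F z.swap = F z) (hKV : K ⊆ V)
    (hsupp : ∀ z : α × α, z.1 ∉ K → z.2 ∉ K → F z = 0)
    (h1 : IntegrableOn F (V ×ˢ V) (μ.prod μ)) (h2 : IntegrableOn F (K ×ˢ Vᶜ) (μ.prod μ)) :
    Integrable F (μ.prod μ) := by
  have h3 : IntegrableOn F (Vᶜ ×ˢ K) (μ.prod μ) := by
    rw [← integrable_indicator_iff (hV.compl.prod hK)]
    rw [← integrable_indicator_iff (hK.prod hV.compl)] at h2
    refine h2.swap.congr (Filter.Eventually.of_forall fun z => ?_)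
    by_cases hz : z ∈ Vᶜ ×ˢ K
    · have hz' : z.swap ∈ K ×ˢ Vᶜ := ⟨hz.2, hz.1⟩
      simp only [Function.comp, indicator_of_mem hz, indicator_of_mem hz', hsymm]
    · have hz' : z.swap ∉ K ×ˢ Vᶜ := fun h => hz ⟨h.2, h.1⟩
      simp only [Function.comp, indicator_of_notMem hz, indicator_of_notMem hz']
  have h4 := (h1.union h2).union h3
  refine (integrableOn_iff_integrable_of_support_subset fun z hz => ?_).1 h4
  by_contra hn
  simp only [mem_union, mem_prod, mem_compl_iff] at hn
  refine hz (hsupp z ?_ ?_)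
  · intro hz1
    have := hKV hz1
    tauto
  · intro hz2
    have := hKV hz2
    tauto

theorem integrableOn_of_gagliardoEnergy_lt_top {N : ℕ} {s p : ℝ}
    {A : Set (EuclideanSpace ℝ (Fin N))} {u : EuclideanSpace ℝ (Fin N) → ℝ} (hu : Measurable u) :
    gagliardoEnergy s p A u < ⊤ ↔
    IntegrableOn (fun z : EuclideanSpace ℝ (Fin N) × EuclideanSpace ℝ (Fin N) =>
      |u z.1 - u z.2| ^ p / ‖z.1 - z.2‖ ^ ((N : ℝ) + s * p)) (A ×ˢ A) := by
  rw [lt_top_iff_ne_top, gagliardoEnergy, lintegral_ofReal_ne_top_iff_integrable, IntegrableOn]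
  · exact Measurable.aestronglyMeasurable (by fun_prop)
  · exact Filter.Eventually.of_forall fun z => by positivity

theorem integrableOn_far {N : ℕ} {K V : Set (EuclideanSpace ℝ (Fin N))} (hK : IsCompact K)
    (hV : IsOpen V) (hKV : K ⊆ V) {r : ℝ} (hr : 0 ≤ r)
    {F : EuclideanSpace ℝ (Fin N) × EuclideanSpace ℝ (Fin N) → ℝ} (hF : Measurable F)
    {g h : EuclideanSpace ℝ (Fin N) → ℝ} (hg0 : ∀ x, 0 ≤ g x) (hh0 : ∀ x, 0 ≤ h x)
    (hg : IntegrableOn g K) (hh : Integrable fun y => h y * (1 + ‖y‖) ^ (-r))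
    (hFgh : ∀ x ∈ K, ∀ y ∉ V, |F (x, y)| ≤ g x * h y / ‖x - y‖ ^ r) :
    IntegrableOn F (K ×ˢ Vᶜ) := by
  obtain ⟨c, hc, hcK⟩ := norm_sub_rpow_inv_le hK hV hKV hr
  have hprod : IntegrableOn (fun z : EuclideanSpace ℝ (Fin N) × EuclideanSpace ℝ (Fin N) =>
      (c * g z.1) * (h z.2 * (1 + ‖z.2‖) ^ (-r))) (K ×ˢ Vᶜ) := by
    rw [IntegrableOn, Measure.volume_eq_prod, ← Measure.prod_restrict]
    exact Integrable.mul_prod (hg.const_mul c) hh.integrableOn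
  refine Integrable.mono' hprod hF.aestronglyMeasurable ?_
  refine (ae_restrict_iff' (hK.measurableSet.prod hV.measurableSet.compl)).2
    (Filter.Eventually.of_forall fun z hz => ?_)
  refine (hFgh z.1 hz.1 z.2 hz.2).trans ?_
  rw [div_eq_mul_inv]
  calc _ ≤ g z.1 * h z.2 * (c * (1 + ‖z.2‖) ^ (-r)) :=
        mul_le_mul_of_nonneg_left (hcK _ hz.1 _ hz.2) (mul_nonneg (hg0 _) (hh0 _))
    _ = _ := by ring

theorem integrable_one_add_norm_rpow_neg {N : ℕ} {r : ℝ} (hr : (N : ℝ) < r) :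
    Integrable fun y : EuclideanSpace ℝ (Fin N) => (1 + ‖y‖) ^ (-r) :=
  integrable_one_add_norm (by rwa [finrank_euclideanSpace_fin])

/-- On K × Vᶜ the second value of ψ vanishes, so the integrand is at most M^p times a kernel
integrable there. This makes the Picone quotient a globally admissible test function. -/
theorem gagliardoEnergy_univ_lt_top {N : ℕ} {s p : ℝ} (hp : 1 < p) (hs : 0 < s)
    {K V : Set (EuclideanSpace ℝ (Fin N))} (hK : IsCompact K)
    (hV : IsOpen V) (hKV : K ⊆ V) {ψ : EuclideanSpace ℝ (Fin N) → ℝ} (hψ : Measurable ψ)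
    (hψK : ∀ x ∉ K, ψ x = 0) {M : ℝ} (hψM : ∀ x, |ψ x| ≤ M)
    (h : gagliardoEnergy s p V ψ < ⊤) : gagliardoEnergy s p univ ψ < ⊤ := by
  rw [integrableOn_of_gagliardoEnergy_lt_top hψ] at h ⊢
  rw [univ_prod_univ, integrableOn_univ]
  refine integrable_of_symmetric hK.measurableSet hV.measurableSet (fun z => ?_) hKV
    (fun z h1 h2 => ?_) h ?_
  · simp only [Prod.fst_swap, Prod.snd_swap]
    rw [abs_sub_comm, norm_sub_rev]
  · simp [hψK _ h1, hψK _ h2, Real.zero_rpow (by linarith : p ≠ 0)]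
  · have hr : (N : ℝ) < (N : ℝ) + s * p := by nlinarith
    refine integrableOn_far (r := (N : ℝ) + s * p) (g := fun _ => M ^ p) (h := fun _ => 1)
      hK hV hKV (by positivity) (by fun_prop)
      (fun x => Real.rpow_nonneg ((abs_nonneg _).trans (hψM x)) _) (fun _ => zero_le_one)
      (integrableOn_const hK.measure_lt_top.ne) ?_ (fun x hx y hy => ?_)
    · simpa using integrable_one_add_norm_rpow_neg hr
    · rw [hψK y (fun h => hy (hKV h)), sub_zero, abs_of_nonneg (by positivity), mul_one]
      gcongr
      exact hψM x

theorem rpow_sub_one_mul_le_add {p x y : ℝ} (hp : 1 < p) (hx : 0 ≤ x) (hy : 0 ≤ y) :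
    x ^ (p - 1) * y ≤ x ^ p + y ^ p := by
  have key : ∀ t : ℝ, 0 ≤ t → t ^ (p - 1) * t = t ^ p := by
    intro t ht
    rw [← Real.rpow_add_one' ht (by linarith)]
    congr 1; ring
  rcases le_total x y with h | h
  · have : x ^ (p - 1) * y ≤ y ^ (p - 1) * y := by gcongr
    rw [key y hy] at this
    have := Real.rpow_nonneg hx p
    linarith
  · have : x ^ (p - 1) * y ≤ x ^ (p - 1) * x := by gcongr
    rw [key x hx] at this
    have := Real.rpow_nonneg hy p
    linarith

/-- Needed to split the Bochner integral in the weak formulation. On V × V a crude Young inequality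
bounds the integrand by the two energy densities. On K × Vᶜ one has |u(x) - u(y)|^(p-1) ≤ u(x)^(p-1)
+ u(y)^(p-1), since u ≥ 0; local integrability handles the first term and the tail condition the
second. -/
theorem integrable_interaction {N : ℕ} {s p : ℝ} (hp : 1 < p) (hs : 0 < s)
    {K V : Set (EuclideanSpace ℝ (Fin N))} (hK : IsCompact K)
    (hV : IsOpen V) (hKV : K ⊆ V) {ψ : EuclideanSpace ℝ (Fin N) → ℝ} (hψ : Measurable ψ)
    (hψK : ∀ x ∉ K, ψ x = 0) {M : ℝ} (hψM : ∀ x, |ψ x| ≤ M)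
    (hψV : gagliardoEnergy s p V ψ < ⊤) {u : EuclideanSpace ℝ (Fin N) → ℝ} (hu : Measurable u)
    (hu0 : ∀ x, 0 ≤ u x) (huV : gagliardoEnergy s p V u < ⊤) (hutail : MemTail s p u) :
    Integrable fun z : EuclideanSpace ℝ (Fin N) × EuclideanSpace ℝ (Fin N) =>
      Jp p (u z.1 - u z.2) * (ψ z.1 - ψ z.2) / ‖z.1 - z.2‖ ^ ((N : ℝ) + s * p) := by
  rw [integrableOn_of_gagliardoEnergy_lt_top hψ] at hψV
  rw [integrableOn_of_gagliardoEnergy_lt_top hu] at huV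
  have hJ := measurable_Jp p
  have hr : (N : ℝ) < (N : ℝ) + s * p := by nlinarith
  have hr0 : 0 ≤ (N : ℝ) + s * p := by positivity
  have hM : ∀ x : EuclideanSpace ℝ (Fin N), 0 ≤ M := fun x => (abs_nonneg _).trans (hψM x)
  refine integrable_of_symmetric hK.measurableSet hV.measurableSet (fun z => ?_) hKV
    (fun z h1 h2 => ?_) ?_ ?_
  · simp only [Prod.fst_swap, Prod.snd_swap]
    rw [norm_sub_rev z.2, ← neg_sub (u z.1), Jp_neg]
    ring
  · simp [hψK _ h1, hψK _ h2]
  · refine Integrable.mono' (huV.add hψV) (Measurable.aestronglyMeasurable (by fun_prop))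
      (Filter.Eventually.of_forall fun z => ?_)
    simp only [Pi.add_apply]
    rw [← add_div, norm_div, norm_mul, Real.norm_eq_abs, Real.norm_eq_abs, abs_Jp hp,
      Real.norm_of_nonneg (by positivity)]
    gcongr
    exact rpow_sub_one_mul_le_add hp (abs_nonneg _) (abs_nonneg _)
  · have hfar : ∀ (g h : EuclideanSpace ℝ (Fin N) → ℝ), Measurable g → Measurable h →
        (∀ x, 0 ≤ g x) → (∀ x, 0 ≤ h x) → IntegrableOn g K →
        (Integrable fun y => h y * (1 + ‖y‖) ^ (-((N : ℝ) + s * p))) →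
        IntegrableOn (fun z : EuclideanSpace ℝ (Fin N) × EuclideanSpace ℝ (Fin N) =>
          g z.1 * h z.2 / ‖z.1 - z.2‖ ^ ((N : ℝ) + s * p)) (K ×ˢ Vᶜ) := by
      intro g h hgm hhm hg0 hh0 hg hh
      refine integrableOn_far hK hV hKV hr0 (by fun_prop) hg0 hh0 hg hh fun x hx y hy => ?_
      rw [abs_of_nonneg]
      exact div_nonneg (mul_nonneg (hg0 _) (hh0 _)) (by positivity)
    have hloc : IntegrableOn (fun x => M * |u x| ^ (p - 1)) K :=
      (hutail.2.1.integrableOn_isCompact hK).const_mul M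
    have hA := hfar (fun x => M * |u x| ^ (p - 1)) (fun _ => 1) (by fun_prop) (by fun_prop)
      (fun x => mul_nonneg (hM x) (by positivity)) (fun _ => zero_le_one) hloc
      (by simpa using integrable_one_add_norm_rpow_neg hr)
    have hB := hfar (fun _ => M) (fun y => |u y| ^ (p - 1)) (by fun_prop) (by fun_prop)
      hM (fun x => by positivity) (integrableOn_const hK.measure_lt_top.ne)
      (by
        refine hutail.2.2.congr (Filter.Eventually.of_forall fun y => ?_)
        simp only
        rw [Real.rpow_neg (by positivity), div_eq_mul_inv])
    refine Integrable.mono' (hA.add hB) (Measurable.aestronglyMeasurable (by fun_prop))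
      ((ae_restrict_iff' (hK.measurableSet.prod hV.measurableSet.compl)).2
        (Filter.Eventually.of_forall fun z hz => ?_))
    simp only [Pi.add_apply]
    rw [hψK z.2 (fun h => hz.2 (hKV h)), sub_zero, ← add_div, norm_div, norm_mul,
      Real.norm_eq_abs, Real.norm_eq_abs, abs_Jp hp, Real.norm_of_nonneg (by positivity)]
    gcongr
    have h1 : |u z.1 - u z.2| ^ (p - 1) ≤ |u z.1| ^ (p - 1) + |u z.2| ^ (p - 1) := by
      rw [abs_of_nonneg (hu0 _), abs_of_nonneg (hu0 z.2)]
      rcases le_total (u z.1) (u z.2) with h | h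
      · have : |u z.1 - u z.2| ≤ u z.2 := by
          rw [abs_le]; constructor <;> linarith [hu0 z.1, hu0 z.2]
        have := Real.rpow_le_rpow (abs_nonneg _) this (by linarith : 0 ≤ p - 1)
        have := Real.rpow_nonneg (hu0 z.1) (p - 1)
        linarith
      · have : |u z.1 - u z.2| ≤ u z.1 := by
          rw [abs_le]; constructor <;> linarith [hu0 z.1, hu0 z.2]
        have := Real.rpow_le_rpow (abs_nonneg _) this (by linarith : 0 ≤ p - 1)
        have := Real.rpow_nonneg (hu0 z.2) (p - 1)
        linarith
    calc _ ≤ (|u z.1| ^ (p - 1) + |u z.2| ^ (p - 1)) * M :=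
          mul_le_mul h1 (hψM _) (abs_nonneg _) (by positivity)
      _ = _ := by ring


/-! ### Divergence of the integral of 1/d near a continuous boundary point -/

theorem lintegral_Ioo_sub_inv_eq_top {a b : ℝ} (hab : a < b) :
    ∫⁻ t in Ioo a b, ENNReal.ofReal (t - a)⁻¹ = ⊤ := by
  by_contra h
  have hae : 0 ≤ᵐ[volume.restrict (Ioo a b)] fun t => (t - a)⁻¹ :=
    (ae_restrict_iff' measurableSet_Ioo).2
      (Filter.Eventually.of_forall fun t ht => inv_nonneg.2 (sub_nonneg.2 ht.1.le))
  rw [← Ne, lintegral_ofReal_ne_top_iff_integrable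
    (Measurable.aestronglyMeasurable (by fun_prop)) hae] at h
  have h2 := (intervalIntegrable_iff_integrableOn_Ioo_of_le (μ := volume) hab.le).2 h
  rcases intervalIntegrable_sub_inv_iff.1 h2 with h3 | h3
  · exact hab.ne h3
  · exact h3 left_mem_uIcc

theorem isOpen_openCube (n : ℕ) (δ : ℝ) : IsOpen (openCube n δ) := by
  have : openCube n δ = Set.pi univ fun _ => Ioo (-δ) δ := by ext; simp [openCube]
  rw [this]
  exact isOpen_set_pi finite_univ fun _ _ => isOpen_Ioo

theorem bdryDist_pos {N : ℕ} {Ω : Set (EuclideanSpace ℝ (Fin N))} (hΩ : IsOpen Ω)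
    (hne : (frontier Ω).Nonempty) {x : EuclideanSpace ℝ (Fin N)} (hx : x ∈ Ω) :
    0 < bdryDist Ω x := by
  refine (isClosed_frontier.notMem_iff_infDist_pos hne).1 fun h => ?_
  rw [hΩ.frontier_eq] at h
  exact h.2 hx

theorem measurePreserving_vert_horiz (n : ℕ)
    (O : EuclideanSpace ℝ (Fin (n + 1)) ≃ᵃⁱ[ℝ] EuclideanSpace ℝ (Fin (n + 1))) :
    MeasurePreserving (fun x => (vert (O x), horiz (O x))) volume
      (volume : Measure (ℝ × (Fin n → ℝ))) := by
  have hO : MeasurePreserving O volume volume := by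
    have h := (measurePreserving_add_right (volume : Measure (EuclideanSpace ℝ (Fin (n + 1))))
      (O 0)).comp O.linearIsometryEquiv.measurePreserving
    have e : ⇑O = (fun x => x + O 0) ∘ O.linearIsometryEquiv := by
      funext x
      simpa using O.map_vadd 0 x
    rw [e]
    exact h
  have h := ((volume_preserving_piFinSuccAbove (fun _ : Fin (n + 1) => ℝ) (Fin.last n)).comp
    (PiLp.volume_preserving_ofLp (Fin (n + 1)))).comp hO
  have e : (fun x => (vert (O x), horiz (O x))) =
      (MeasurableEquiv.piFinSuccAbove (fun _ : Fin (n + 1) => ℝ) (Fin.last n) ∘ WithLp.ofLp) ∘ O := by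
    funext x
    refine Prod.ext rfl (funext fun j => ?_)
    simp [horiz, MeasurableEquiv.piFinSuccAbove, Fin.insertNthEquiv, Fin.init]
  rw [e]
  exact h

/-- Dropping vertically from x onto the graph reaches a boundary point, so d(x) ≤ x_N - Ψ(x') in the
local coordinates. Hence 1/d has infinite integral along each vertical segment above the cube, and
Tonelli applies. -/
theorem lintegral_inv_bdryDist_eq_top {n : ℕ} {Ω : Set (EuclideanSpace ℝ (Fin (n + 1)))}
    (hΩ : IsOpen Ω) {x₀ : EuclideanSpace ℝ (Fin (n + 1))}
    (hx₀ : LocallyContinuousBoundaryAt Ω x₀) :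
    ∫⁻ x in Ω, ENNReal.ofReal (bdryDist Ω x)⁻¹ = ⊤ := by
  obtain ⟨hfr, δ₀, δ₁, O, Ψ, hδ₀, hδ₁, -, hΨc, hΨm, h1, h2⟩ := hx₀
  have hcube := isOpen_openCube n δ₀
  -- Ψ is controlled only on the cube; its extension by zero is measurable everywhere.
  have hΨ' : Measurable ((openCube n δ₀).indicator Ψ) := by
    classical
    rw [← Set.piecewise_eq_indicator]
    exact hΨc.measurable_piecewise continuousOn_const hcube.measurableSet
  set Θ := (openCube n δ₀).indicator Ψ with hΘ
  set S : Set (ℝ × (Fin n → ℝ)) := {w | w.2 ∈ openCube n δ₀ ∧ Θ w.2 < w.1 ∧ w.1 < δ₁} with hS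
  have hSm : MeasurableSet S :=
    (measurable_snd hcube.measurableSet).inter
      ((measurableSet_lt (hΨ'.comp measurable_snd) measurable_fst).inter
        (measurableSet_lt measurable_fst measurable_const))
  set G : ℝ × (Fin n → ℝ) → ℝ≥0∞ := S.indicator fun w => ENNReal.ofReal (w.1 - Θ w.2)⁻¹ with hG
  have hGm : Measurable G := Measurable.indicator (by fun_prop) hSm
  have hmp := measurePreserving_vert_horiz n O
  have key : ∀ x, G (vert (O x), horiz (O x)) ≤
      Ω.indicator (fun x => ENNReal.ofReal (bdryDist Ω x)⁻¹) x := by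
    intro x
    by_cases hw : (vert (O x), horiz (O x)) ∈ S
    · obtain ⟨hc, hlt, hlt'⟩ := hw
      have hΘΨ : Θ (horiz (O x)) = Ψ (horiz (O x)) := indicator_of_mem hc _
      simp only [hΘΨ] at hlt hlt'
      have hbd := hΨm hc
      have hQ : O x ∈ hyperRect n δ₀ δ₁ := ⟨hc, hbd.1.trans hlt, hlt'⟩
      have hxΩ : x ∈ Ω := by
        have : O x ∈ hyperRect n δ₀ δ₁ ∩ O '' Ω := by
          rw [h1]; exact ⟨hQ, hlt, hlt'⟩
        obtain ⟨y, hy, hyx⟩ := this.2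
        rwa [← O.injective hyx]
      rw [indicator_of_mem hxΩ, hG, indicator_of_mem (show _ ∈ S from
        ⟨hc, by simpa only [hΘΨ] using hlt, hlt'⟩)]
      simp only [hΘΨ]
      -- The point of the graph vertically below `O x`.
      set w : EuclideanSpace ℝ (Fin (n + 1)) := O x +
        EuclideanSpace.single (Fin.last n) (Ψ (horiz (O x)) - vert (O x)) with hwdef
      have hwh : horiz w = horiz (O x) := by
        funext i
        simp [horiz, hwdef, Fin.castSucc_ne_last]
      have hwv : vert w = Ψ (horiz (O x)) := by
        simp [vert, hwdef]
      have hwfr : w ∈ hyperRect n δ₀ δ₁ ∩ O '' frontier Ω := by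
        rw [h2]
        refine ⟨⟨?_, ?_⟩, ?_⟩
        · rwa [hwh]
        · rwa [hwv]
        · rw [hwv, hwh]
      obtain ⟨q, hq, hqw⟩ := hwfr.2
      have hd : bdryDist Ω x ≤ vert (O x) - Ψ (horiz (O x)) := by
        refine (Metric.infDist_le_dist_of_mem hq).trans ?_
        rw [← O.dist_map x q, hqw, dist_comm, dist_eq_norm, hwdef, add_sub_cancel_left,
          PiLp.norm_single, Real.norm_eq_abs, abs_sub_comm,
          abs_of_pos (sub_pos.2 hlt)]
      exact ENNReal.ofReal_le_ofReal (inv_anti₀ (bdryDist_pos hΩ ⟨x₀, hfr⟩ hxΩ) hd)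
    · rw [hG, indicator_of_notMem hw]
      exact zero_le
  rw [← lintegral_indicator hΩ.measurableSet, eq_top_iff]
  refine le_trans ?_ (lintegral_mono key)
  rw [hmp.lintegral_comp hGm, Measure.volume_eq_prod, lintegral_prod_symm' _ hGm]
  have hinner : ∀ y ∈ openCube n δ₀, ∫⁻ t, G (t, y) = ⊤ := by
    intro y hy
    have hy' : Θ y = Ψ y := indicator_of_mem hy _
    have : ∀ t, G (t, y) = (Ioo (Ψ y) δ₁).indicator (fun t => ENNReal.ofReal (t - Ψ y)⁻¹) t := by
      intro t
      have hiff : (t, y) ∈ S ↔ t ∈ Ioo (Ψ y) δ₁ := by simp [hS, hy', hy]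
      by_cases ht : t ∈ Ioo (Ψ y) δ₁
      · rw [hG, indicator_of_mem (hiff.2 ht), indicator_of_mem ht, hy']
      · rw [hG, indicator_of_notMem fun h => ht (hiff.1 h), indicator_of_notMem ht]
    simp_rw [this]
    rw [lintegral_indicator measurableSet_Ioo]
    exact lintegral_Ioo_sub_inv_eq_top (hΨm hy).2
  calc (⊤ : ℝ≥0∞) = ∫⁻ _ in openCube n δ₀, ⊤ := by
        rw [setLIntegral_const, ENNReal.top_mul]
        exact (hcube.measure_pos volume ⟨0, fun i => by simp [hδ₀]⟩).ne'
    _ = ∫⁻ y in openCube n δ₀, ∫⁻ t, G (t, y) :=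
        (setLIntegral_congr_fun hcube.measurableSet fun y hy => hinner y hy).symm
    _ ≤ _ := setLIntegral_le_lintegral _ _


/-! ### The seminorm as an L^p norm, and change of representative -/

/-- Makes Minkowski's inequality in L^p available for the seminorm. -/
theorem gagliardoEnergy_rpow_eq_eLpNorm {N : ℕ} {s p : ℝ} (hp : 1 < p)
    (u : EuclideanSpace ℝ (Fin N) → ℝ) :
    gagliardoEnergy s p univ u ^ (1 / p) =
      eLpNorm (fun z : EuclideanSpace ℝ (Fin N) × EuclideanSpace ℝ (Fin N) =>
        (u z.1 - u z.2) / ‖z.1 - z.2‖ ^ (((N : ℝ) + s * p) / p)) (ENNReal.ofReal p) volume := by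
  have hp0 : 0 < p := by linarith
  rw [eLpNorm_eq_lintegral_rpow_enorm_toReal (by simpa using hp0) ENNReal.ofReal_ne_top,
    ENNReal.toReal_ofReal hp0.le, gagliardoEnergy, univ_prod_univ, Measure.restrict_univ]
  congr 1
  refine lintegral_congr fun z => ?_
  rw [Real.enorm_eq_ofReal_abs, ENNReal.ofReal_rpow_of_nonneg (abs_nonneg _) hp0.le, abs_div,
    Real.div_rpow (abs_nonneg _) (abs_nonneg _),
    abs_of_nonneg (Real.rpow_nonneg (norm_nonneg (z.1 - z.2)) _), ← Real.rpow_mul (norm_nonneg _),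
    div_mul_cancel₀ _ hp0.ne']

theorem gagliardoEnergy_rpow_le {N : ℕ} {s p : ℝ} (hp : 1 < p)
    {v φ : EuclideanSpace ℝ (Fin N) → ℝ} (hv : AEMeasurable v) (hφ : AEMeasurable φ) :
    gagliardoEnergy s p univ φ ^ (1 / p) ≤
      gagliardoEnergy s p univ v ^ (1 / p) + gagliardoEnergy s p univ (v - φ) ^ (1 / p) := by
  have hmeas : ∀ w : EuclideanSpace ℝ (Fin N) → ℝ, AEMeasurable w →
      AEStronglyMeasurable (fun z : EuclideanSpace ℝ (Fin N) × EuclideanSpace ℝ (Fin N) =>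
        (w z.1 - w z.2) / ‖z.1 - z.2‖ ^ (((N : ℝ) + s * p) / p)) volume := by
    intro w hw
    have h1 : AEMeasurable (fun z : EuclideanSpace ℝ (Fin N) × EuclideanSpace ℝ (Fin N) => w z.1)
        volume := hw.comp_quasiMeasurePreserving Measure.quasiMeasurePreserving_fst
    have h2 : AEMeasurable (fun z : EuclideanSpace ℝ (Fin N) × EuclideanSpace ℝ (Fin N) => w z.2)
        volume := hw.comp_quasiMeasurePreserving Measure.quasiMeasurePreserving_snd
    exact ((h1.sub h2).div (by fun_prop)).aestronglyMeasurable
  simp only [gagliardoEnergy_rpow_eq_eLpNorm hp]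
  refine le_trans (le_of_eq ?_) (eLpNorm_sub_le (hmeas v hv) (hmeas _ (hv.sub hφ)) ?_)
  · congr 1
    funext z
    simp only [Pi.sub_apply]
    ring
  · exact ENNReal.one_le_ofReal.2 hp.le

theorem gagliardoEnergy_congr {N : ℕ} {s p : ℝ} {A : Set (EuclideanSpace ℝ (Fin N))}
    {u w : EuclideanSpace ℝ (Fin N) → ℝ} (h : u =ᵐ[volume] w) :
    gagliardoEnergy s p A u = gagliardoEnergy s p A w := by
  have h1 : ∀ᵐ z : EuclideanSpace ℝ (Fin N) × EuclideanSpace ℝ (Fin N), u z.1 = w z.1 :=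
    Measure.quasiMeasurePreserving_fst.ae h
  have h2 : ∀ᵐ z : EuclideanSpace ℝ (Fin N) × EuclideanSpace ℝ (Fin N), u z.2 = w z.2 :=
    Measure.quasiMeasurePreserving_snd.ae h
  refine lintegral_congr_ae (ae_restrict_of_ae ?_)
  filter_upwards [h1, h2] with z h1 h2
  rw [h1, h2]

/-- Allows u to be replaced by a Borel representative that is nonnegative everywhere. -/
theorem IsLocalWeakSupersolution.congr {N : ℕ} {s p lam : ℝ}
    {Ω : Set (EuclideanSpace ℝ (Fin N))} {u w : EuclideanSpace ℝ (Fin N) → ℝ}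
    (hu : IsLocalWeakSupersolution s p Ω lam u) (h : u =ᵐ[volume] w) :
    IsLocalWeakSupersolution s p Ω lam w := by
  obtain ⟨⟨h1, h2⟩, ⟨h3, h4, h5⟩, h6⟩ := hu
  refine ⟨⟨fun K hK hKΩ => (h1 K hK hKΩ).ae_eq (ae_restrict_of_ae h),
    fun V hV hVc hVΩ => ⟨(h2 V hV hVc hVΩ).1.ae_eq (ae_restrict_of_ae h), ?_⟩⟩,
    ⟨h3.congr h, h4.congr ?_, h5.congr ?_⟩, fun φ hφ hc hsub hpos => ?_⟩
  · rw [← gagliardoEnergy_congr h]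
    exact (h2 V hV hVc hVΩ).2
  · filter_upwards [h] with x hx
    rw [hx]
  · filter_upwards [h] with x hx
    rw [hx]
  · have h1 : ∀ᵐ z : EuclideanSpace ℝ (Fin N) × EuclideanSpace ℝ (Fin N), u z.1 = w z.1 :=
      Measure.quasiMeasurePreserving_fst.ae h
    have h2 : ∀ᵐ z : EuclideanSpace ℝ (Fin N) × EuclideanSpace ℝ (Fin N), u z.2 = w z.2 :=
      Measure.quasiMeasurePreserving_snd.ae h
    have e1 : ∫ x in Ω, Jp p (u x) / bdryDist Ω x ^ (s * p) * φ x =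
        ∫ x in Ω, Jp p (w x) / bdryDist Ω x ^ (s * p) * φ x := by
      refine integral_congr_ae (ae_restrict_of_ae ?_)
      filter_upwards [h] with x hx
      rw [hx]
    have e2 : ∫ z : EuclideanSpace ℝ (Fin N) × EuclideanSpace ℝ (Fin N),
          Jp p (u z.1 - u z.2) * (φ z.1 - φ z.2) / ‖z.1 - z.2‖ ^ ((N : ℝ) + s * p) =
        ∫ z : EuclideanSpace ℝ (Fin N) × EuclideanSpace ℝ (Fin N),
          Jp p (w z.1 - w z.2) * (φ z.1 - φ z.2) / ‖z.1 - z.2‖ ^ ((N : ℝ) + s * p) := by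
      refine integral_congr_ae ?_
      filter_upwards [h1, h2] with z h1 h2
      rw [h1, h2]
    rw [← e1, ← e2]
    exact h6 φ hφ hc hsub hpos

/-! ### The ground state inequality for test functions -/

/-- The remainder in the discrete Picone inequality, with `u` regularized to `u + ε`. -/
noncomputable def piconeRemainder {N : ℕ} (s p ε : ℝ) (u v : EuclideanSpace ℝ (Fin N) → ℝ)
    (z : EuclideanSpace ℝ (Fin N) × EuclideanSpace ℝ (Fin N)) : ℝ :=
  (|(|v z.1| - |v z.2|)| ^ p - Jp p (u z.1 - u z.2) *
    (|v z.1| ^ p / (u z.1 + ε) ^ (p - 1) - |v z.2| ^ p / (u z.2 + ε) ^ (p - 1))) /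
      ‖z.1 - z.2‖ ^ ((N : ℝ) + s * p)

theorem piconeRemainder_nonneg {N : ℕ} {s p ε : ℝ} (hp : 1 < p) (hε : 0 < ε)
    {u : EuclideanSpace ℝ (Fin N) → ℝ} (hu : ∀ x, 0 ≤ u x) (v : EuclideanSpace ℝ (Fin N) → ℝ)
    (z : EuclideanSpace ℝ (Fin N) × EuclideanSpace ℝ (Fin N)) :
    0 ≤ piconeRemainder s p ε u v z := by
  have := (picone hp (a := u z.1 + ε) (b := u z.2 + ε) (by linarith [hu z.1])
    (by linarith [hu z.2]) (abs_nonneg (v z.1)) (abs_nonneg (v z.2))).1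
  -- The shift by ε cancels in the difference, so `Jp` acts on u itself, as in the equation.
  rw [add_sub_add_right_eq_sub] at this
  exact div_nonneg (sub_nonneg.2 this) (by positivity)

/-- With ε > 0 and φ bounded, the quotient is a Lipschitz function of the pair (φ, u), so its energy
density is controlled by those of φ and u. -/
theorem gagliardoEnergy_quotient_lt_top {N : ℕ} {s p ε : ℝ} (hp : 1 < p) (hε : 0 < ε)
    {V : Set (EuclideanSpace ℝ (Fin N))} {u φ : EuclideanSpace ℝ (Fin N) → ℝ}
    (hu : Measurable u) (hu0 : ∀ x, 0 ≤ u x) (hφ : Measurable φ) {M : ℝ} (hM : ∀ x, |φ x| ≤ M)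
    (huV : gagliardoEnergy s p V u < ⊤) (hφV : gagliardoEnergy s p V φ < ⊤) :
    gagliardoEnergy s p V (fun x => |φ x| ^ p / (u x + ε) ^ (p - 1)) < ⊤ := by
  rw [integrableOn_of_gagliardoEnergy_lt_top (by fun_prop)] at huV hφV ⊢
  set c₁ := p * M ^ (p - 1) * (ε ^ (p - 1))⁻¹
  set c₂ := M ^ p * ((p - 1) * ε ^ (-(p - 1) - 1))
  have hdom := ((hφV.const_mul (2 ^ (p - 1) * |c₁| ^ p)).add
    (huV.const_mul (2 ^ (p - 1) * |c₂| ^ p)))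
  refine Integrable.mono' hdom (Measurable.aestronglyMeasurable (by fun_prop))
    (Filter.Eventually.of_forall fun z => ?_)
  rw [Real.norm_of_nonneg (by positivity)]
  simp only [Pi.add_apply]
  rw [← mul_div_assoc, ← mul_div_assoc, ← add_div]
  refine div_le_div_of_nonneg_right ?_ (by positivity)
  have h1 := abs_quotient_sub_le hp hε (hM z.1) (hM z.2) (hu0 z.1) (hu0 z.2)
  have h2 : c₁ * |φ z.1 - φ z.2| + c₂ * |u z.1 - u z.2| ≤
      |c₁| * |φ z.1 - φ z.2| + |c₂| * |u z.1 - u z.2| := by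
    gcongr <;> exact le_abs_self _
  calc _ ≤ (|c₁| * |φ z.1 - φ z.2| + |c₂| * |u z.1 - u z.2|) ^ p :=
        Real.rpow_le_rpow (abs_nonneg _) (h1.trans h2) (by linarith)
    _ ≤ 2 ^ (p - 1) * ((|c₁| * |φ z.1 - φ z.2|) ^ p + (|c₂| * |u z.1 - u z.2|) ^ p) :=
        mod_cast NNReal.rpow_add_le_mul_rpow_add_rpow ⟨|c₁| * |φ z.1 - φ z.2|, by positivity⟩
          ⟨|c₂| * |u z.1 - u z.2|, by positivity⟩ hp.le
    _ = _ := by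
        rw [Real.mul_rpow (by positivity) (by positivity),
          Real.mul_rpow (by positivity) (by positivity)]
        ring

/-- The ground state inequality: testing the equation with `|φ|^p / (u + ε)^(p - 1)`. -/
theorem hardy_add_piconeRemainder_le {N : ℕ} {s p lam ε : ℝ} (hp : 1 < p) (hs : 0 < s)
    (hlam : 0 ≤ lam) (hε : 0 < ε) {Ω : Set (EuclideanSpace ℝ (Fin N))} (hΩ : IsOpen Ω)
    (hne : (frontier Ω).Nonempty) {u φ : EuclideanSpace ℝ (Fin N) → ℝ}
    (hu : IsLocalWeakSupersolution s p Ω lam u) (hum : Measurable u) (hu0 : ∀ x, 0 ≤ u x)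
    (hφ : IsTest Ω φ) (hφE : gagliardoEnergy s p univ φ < ⊤) :
    ENNReal.ofReal lam * (∫⁻ x in Ω, ENNReal.ofReal
        ((u x / (u x + ε)) ^ (p - 1) * (|φ x| ^ p / bdryDist Ω x ^ (s * p)))) +
      ∫⁻ z, ENNReal.ofReal (piconeRemainder s p ε u φ z) ≤ gagliardoEnergy s p univ φ := by
  obtain ⟨hφs, hφc, hφΩ⟩ := hφ
  have hφm : Measurable φ := hφs.continuous.measurable
  have hK : IsCompact (tsupport φ) := hφc
  obtain ⟨V, hVo, hKV, hVΩ, hVc⟩ := exists_open_between_and_isCompact_closure hK hΩ hφΩ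
  obtain ⟨M, hM⟩ := hφs.continuous.bounded_above_of_compact_support hφc
  have hM' : ∀ x, |φ x| ≤ M := hM
  set ψ : EuclideanSpace ℝ (Fin N) → ℝ := fun x => |φ x| ^ p / (u x + ε) ^ (p - 1) with hψ
  have hψm : Measurable ψ := by fun_prop
  have hψ0 : ∀ x, 0 ≤ ψ x := fun x => by have := hu0 x; positivity
  have hsub : Function.support ψ ⊆ Function.support φ := by
    intro x hx hx0
    refine hx ?_
    simp [hψ, hx0, Real.zero_rpow (by linarith : p ≠ 0)]
  have hψK : ∀ x ∉ tsupport φ, ψ x = 0 := fun x hx => by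
    by_contra h
    exact hx (subset_tsupport φ (hsub h))
  have hψM : ∀ x, |ψ x| ≤ M ^ p / ε ^ (p - 1) := by
    intro x
    rw [abs_of_nonneg (hψ0 x)]
    have h1 := hu0 x
    have h0 : 0 ≤ M := (abs_nonneg _).trans (hM' x)
    have := hM' x
    simp only [hψ]
    gcongr
    linarith
  have huV : gagliardoEnergy s p V u < ⊤ := (hu.1.2 V hVo hVc hVΩ).2
  have hφV : gagliardoEnergy s p V φ < ⊤ :=
    (lintegral_mono_set (prod_mono (subset_univ _) (subset_univ _))).trans_lt hφE
  have hψV := gagliardoEnergy_quotient_lt_top hp hε hum hu0 hφm hM' huV hφV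
  have hψW : MemW s p univ ψ := by
    refine ⟨?_, gagliardoEnergy_univ_lt_top hp hs hK hVo hKV hψm hψK hψM hψV⟩
    rw [Measure.restrict_univ]
    have : MemLp ψ (ENNReal.ofReal p) (volume.restrict (tsupport φ)) := by
      have : IsFiniteMeasure (volume.restrict (tsupport φ)) :=
        ⟨by simpa using hK.measure_lt_top⟩
      exact MemLp.of_bound hψm.aestronglyMeasurable _ (Filter.Eventually.of_forall hψM)
    rw [← memLp_indicator_iff_restrict hK.measurableSet] at this
    rwa [indicator_eq_self.2 (hsub.trans (subset_tsupport φ))] at this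
  have hts : tsupport ψ ⊆ tsupport φ := closure_mono hsub
  have hweak := hu.2.2 ψ hψW (HasCompactSupport.mono hφc hsub) (hts.trans hφΩ) hψ0
  have hFint := integrable_interaction hp hs hK hVo hKV hψm hψK hψM hψV hum hu0 huV hu.2.1
  have hG' : Integrable fun z : EuclideanSpace ℝ (Fin N) × EuclideanSpace ℝ (Fin N) =>
      |φ z.1 - φ z.2| ^ p / ‖z.1 - z.2‖ ^ ((N : ℝ) + s * p) := by
    rw [integrableOn_of_gagliardoEnergy_lt_top hφm] at hφE
    simpa using hφE
  -- Picone concerns nonnegative functions, hence |φ|; passing from φ to |φ| does not increase the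
  -- energy.
  have hle : ∀ z : EuclideanSpace ℝ (Fin N) × EuclideanSpace ℝ (Fin N),
      |(|φ z.1| - |φ z.2|)| ^ p / ‖z.1 - z.2‖ ^ ((N : ℝ) + s * p) ≤
      |φ z.1 - φ z.2| ^ p / ‖z.1 - z.2‖ ^ ((N : ℝ) + s * p) := fun z =>
    div_le_div_of_nonneg_right (Real.rpow_le_rpow (abs_nonneg _)
      (abs_abs_sub_abs_le_abs_sub _ _) (by linarith)) (by positivity)
  have hG : Integrable fun z : EuclideanSpace ℝ (Fin N) × EuclideanSpace ℝ (Fin N) =>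
      |(|φ z.1| - |φ z.2|)| ^ p / ‖z.1 - z.2‖ ^ ((N : ℝ) + s * p) := by
    refine Integrable.mono' hG' (Measurable.aestronglyMeasurable (by fun_prop))
      (Filter.Eventually.of_forall fun z => ?_)
    rw [Real.norm_of_nonneg (by positivity)]
    exact hle z
  have hR : ∀ z, piconeRemainder s p ε u φ z =
      |(|φ z.1| - |φ z.2|)| ^ p / ‖z.1 - z.2‖ ^ ((N : ℝ) + s * p) -
      Jp p (u z.1 - u z.2) * (ψ z.1 - ψ z.2) / ‖z.1 - z.2‖ ^ ((N : ℝ) + s * p) :=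
    fun z => sub_div _ _ _
  have hRint : Integrable (piconeRemainder s p ε u φ) :=
    (hG.sub hFint).congr (Filter.Eventually.of_forall fun z => (hR z).symm)
  have hRi : ∫ z, piconeRemainder s p ε u φ z =
      (∫ z : EuclideanSpace ℝ (Fin N) × EuclideanSpace ℝ (Fin N),
        |(|φ z.1| - |φ z.2|)| ^ p / ‖z.1 - z.2‖ ^ ((N : ℝ) + s * p)) -
      ∫ z : EuclideanSpace ℝ (Fin N) × EuclideanSpace ℝ (Fin N),
        Jp p (u z.1 - u z.2) * (ψ z.1 - ψ z.2) / ‖z.1 - z.2‖ ^ ((N : ℝ) + s * p) := by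
    rw [← integral_sub hG hFint]
    exact integral_congr_ae (Filter.Eventually.of_forall hR)
  have hdpos : ∀ x ∈ Ω, 0 < bdryDist Ω x := fun x hx => bdryDist_pos hΩ hne hx
  have hdc : Continuous (bdryDist Ω) := Metric.continuous_infDist_pt _
  have hdm : Measurable (bdryDist Ω) := hdc.measurable
  set f : EuclideanSpace ℝ (Fin N) → ℝ := fun x =>
    (u x / (u x + ε)) ^ (p - 1) * (|φ x| ^ p / bdryDist Ω x ^ (s * p)) with hf
  have hf0 : ∀ x, 0 ≤ f x := fun x => by
    have := hu0 x
    have : 0 ≤ bdryDist Ω x := Metric.infDist_nonneg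
    positivity
  have hfψ : ∀ x, Jp p (u x) / bdryDist Ω x ^ (s * p) * ψ x = f x := fun x => by
    have := hu0 x
    simp only [hf, hψ]
    rw [Jp_of_nonneg hp (hu0 x), Real.div_rpow (hu0 x) (by linarith)]
    ring
  -- On the compact support of φ the distance is continuous and positive, and u / (u + ε) ≤ 1.
  have hfint : IntegrableOn f Ω := by
    have hcont : ContinuousOn (fun x => |φ x| ^ p / bdryDist Ω x ^ (s * p)) (tsupport φ) := by
      refine ContinuousOn.div ?_ ?_ fun x hx => ?_
      · exact (hφs.continuous.abs.rpow_const fun x => Or.inr (by linarith)).continuousOn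
      · exact hdc.continuousOn.rpow_const fun x hx => Or.inl (hdpos x (hφΩ hx)).ne'
      · exact (Real.rpow_pos_of_pos (hdpos x (hφΩ hx)) _).ne'
    have hi := hcont.integrableOn_compact hK (μ := volume)
    have hi2 : IntegrableOn f (tsupport φ) := by
      refine Integrable.mono' hi (Measurable.aestronglyMeasurable (by fun_prop))
        (Filter.Eventually.of_forall fun x => ?_)
      rw [Real.norm_of_nonneg (hf0 x)]
      have h0 := hu0 x
      have : 0 ≤ bdryDist Ω x := Metric.infDist_nonneg
      refine mul_le_of_le_one_left (by positivity) (Real.rpow_le_one (by positivity) ?_ (by linarith))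
      rw [div_le_one (by positivity)]
      linarith
    refine ((integrableOn_iff_integrable_of_support_subset fun x hx => ?_).1 hi2).integrableOn
    by_contra h
    refine hx ?_
    simp only [hf, image_eq_zero_of_notMem_tsupport h, abs_zero,
      Real.zero_rpow (by linarith : p ≠ 0), zero_div, mul_zero]
  simp_rw [hfψ] at hweak
  have hR0 := piconeRemainder_nonneg (s := s) hp hε hu0 φ
  rw [← ofReal_integral_eq_lintegral_ofReal hfint (Filter.Eventually.of_forall hf0),
    ← ofReal_integral_eq_lintegral_ofReal hRint (Filter.Eventually.of_forall hR0),
    ← ENNReal.ofReal_mul hlam,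
    ← ENNReal.ofReal_add (mul_nonneg hlam (integral_nonneg hf0)) (integral_nonneg hR0), hRi,
    gagliardoEnergy, univ_prod_univ, Measure.restrict_univ,
    ← ofReal_integral_eq_lintegral_ofReal hG' (Filter.Eventually.of_forall fun z => by positivity)]
  refine ENNReal.ofReal_le_ofReal ?_
  have := integral_mono hG hG' hle
  linarith


/-! ### Passage to the limit -/

open Filter Topology

/-- Superadditivity of the lower limit, so that Fatou can be applied to the Hardy term and the
remainder separately. -/
theorem liminf_add_liminf_le_of_tendsto {a b e : ℕ → ℝ≥0∞} {L : ℝ≥0∞}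
    (h : ∀ k, a k + b k ≤ e k) (he : Tendsto e atTop (𝓝 L)) :
    liminf a atTop + liminf b atTop ≤ L := by
  rw [liminf_eq_iSup_iInf_of_nat, liminf_eq_iSup_iInf_of_nat]
  rw [ENNReal.iSup_add_iSup_of_monotone]
  · refine iSup_le fun m => ge_of_tendsto he ?_
    filter_upwards [eventually_ge_atTop m] with k hk
    exact (add_le_add (iInf₂_le k hk) (iInf₂_le k hk)).trans (h k)
  · exact fun i j hij => le_iInf₂ fun k hk => iInf₂_le k (hij.trans hk)
  · exact fun i j hij => le_iInf₂ fun k hk => iInf₂_le k (hij.trans hk)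

/-- Test functions approximating an element of the closure of `C^∞_0(Ω)` can be chosen to converge
almost everywhere. -/
theorem MemWTildeZero.exists_seq {N : ℕ} {s p : ℝ} (hp : 1 < p)
    {Ω : Set (EuclideanSpace ℝ (Fin N))} {v : EuclideanSpace ℝ (Fin N) → ℝ}
    (hv : MemWTildeZero s p Ω v) :
    ∃ (φ : ℕ → EuclideanSpace ℝ (Fin N) → ℝ) (e : ℕ → ℝ≥0∞), (∀ k, IsTest Ω (φ k)) ∧
      (∀ᵐ x, Tendsto (fun k => φ k x) atTop (𝓝 (v x))) ∧
      (∀ k, gagliardoEnergy s p univ (φ k) ≤ e k) ∧ (∀ k, e k < ⊤) ∧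
      Tendsto e atTop (𝓝 (gagliardoEnergy s p univ v)) := by
  have hp0 : 0 < p := by linarith
  obtain ⟨⟨hvL, hvE⟩, happ⟩ := hv
  rw [Measure.restrict_univ] at hvL
  have hε : ∀ k : ℕ, (0 : ℝ≥0∞) < ((k : ℝ≥0∞) + 1)⁻¹ := fun k => by simp
  choose φ hφ hφε using fun k : ℕ => happ _ (hε k)
  have hε0 : Tendsto (fun k : ℕ => ((k : ℝ≥0∞) + 1)⁻¹) atTop (𝓝 0) := by
    simpa using (tendsto_add_atTop_iff_nat 1).2 ENNReal.tendsto_inv_nat_nhds_zero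
  have hLp : Tendsto (fun k => eLpNorm (φ k - v) (ENNReal.ofReal p) volume) atTop (𝓝 0) := by
    refine tendsto_of_tendsto_of_tendsto_of_le_of_le tendsto_const_nhds hε0 (fun _ => zero_le)
      fun k => ?_
    simp only
    rw [eLpNorm_sub_comm]
    exact le_self_add.trans (hφε k).le
  have hφm : ∀ k, Measurable (φ k) := fun k => (hφ k).1.continuous.measurable
  obtain ⟨ns, hns, hae⟩ := (tendstoInMeasure_of_tendsto_eLpNorm (by simpa using hp0)
    (fun k => (hφm k).aestronglyMeasurable) hvL.1 hLp).exists_seq_tendsto_ae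
  -- `e k` is the bound on the energy of the approximant given by the triangle inequality; unlike
  -- that energy, it is finite and convergent by inspection.
  refine ⟨fun k => φ (ns k), fun k => (gagliardoEnergy s p univ v ^ (1 / p) +
    ((ns k : ℝ≥0∞) + 1)⁻¹) ^ p, fun k => hφ _, hae, fun k => ?_, fun k => ?_, ?_⟩
  · have h1 := gagliardoEnergy_rpow_le (s := s) hp hvL.1.aemeasurable (hφm (ns k)).aemeasurable
    have h2 := h1.trans (add_le_add_right (le_add_self.trans (hφε (ns k)).le) _)
    have h3 := ENNReal.rpow_le_rpow h2 hp0.le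
    rwa [← ENNReal.rpow_mul, one_div_mul_cancel hp0.ne', ENNReal.rpow_one] at h3
  · refine ENNReal.rpow_lt_top_of_nonneg hp0.le (ENNReal.add_ne_top.2 ⟨?_, by simp⟩)
    exact ENNReal.rpow_ne_top_of_nonneg (by positivity) hvE.ne
  · have h1 : Tendsto (fun k => gagliardoEnergy s p univ v ^ (1 / p) + ((ns k : ℝ≥0∞) + 1)⁻¹)
        atTop (𝓝 (gagliardoEnergy s p univ v ^ (1 / p) + 0)) :=
      tendsto_const_nhds.add (hε0.comp hns.tendsto_atTop)
    have h2 := (ENNReal.continuous_rpow_const (y := p)).continuousAt.tendsto.comp h1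
    rwa [add_zero, ← ENNReal.rpow_mul, one_div_mul_cancel hp0.ne', ENNReal.rpow_one] at h2

/-- The ground state inequality for elements of the closure of `C^∞_0(Ω)`. -/
theorem hardyIntegral_add_piconeRemainder_le {N : ℕ} {s p lam : ℝ} (hp : 1 < p) (hs : 0 < s)
    (hlam : 0 ≤ lam) {Ω : Set (EuclideanSpace ℝ (Fin N))} (hΩ : IsOpen Ω)
    (hne : (frontier Ω).Nonempty) {u v : EuclideanSpace ℝ (Fin N) → ℝ}
    (hu : IsLocalWeakSupersolution s p Ω lam u) (hum : Measurable u) (hu0 : ∀ x, 0 ≤ u x)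
    (hupos : ∀ᵐ x ∂(volume.restrict Ω), 0 < u x) (hv : MemWTildeZero s p Ω v) :
    ENNReal.ofReal lam * hardyIntegral s p Ω v +
      ∫⁻ z in Ω ×ˢ Ω, ENNReal.ofReal (piconeRemainder s p 0 u v z) ≤
        gagliardoEnergy s p univ v := by
  have hp0 : 0 < p := by linarith
  obtain ⟨φ, e, hφ, hae, hle, hlt, he⟩ := hv.exists_seq hp
  have hφm : ∀ k, Measurable (φ k) := fun k => (hφ k).1.continuous.measurable
  have hdm : Measurable (bdryDist Ω) := (Metric.continuous_infDist_pt _).measurable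
  have hJ := measurable_Jp p
  have hε : ∀ k : ℕ, (0 : ℝ) < 1 / ((k : ℝ) + 1) := fun k => Nat.one_div_pos_of_nat
  have hε0 : Tendsto (fun k : ℕ => 1 / ((k : ℝ) + 1)) atTop (𝓝 0) :=
    tendsto_one_div_add_atTop_nhds_zero_nat
  have hmain := fun k => (hardy_add_piconeRemainder_le hp hs hlam (hε k) hΩ hne hu hum hu0 (hφ k)
    ((hle k).trans_lt (hlt k))).trans (hle k)
  refine le_trans (add_le_add ?_ ?_) (liminf_add_liminf_le_of_tendsto hmain he)
  · rw [hardyIntegral, ← lintegral_const_mul' _ _ ENNReal.ofReal_ne_top]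
    simp_rw [← lintegral_const_mul' _ _ ENNReal.ofReal_ne_top]
    refine le_trans (le_of_eq (lintegral_congr_ae ?_)) (lintegral_liminf_le fun k => by fun_prop)
    filter_upwards [hupos, ae_restrict_of_ae hae] with x hx hxv
    refine (Tendsto.liminf_eq ?_).symm
    refine ENNReal.Tendsto.const_mul ?_ (Or.inr ENNReal.ofReal_ne_top)
    refine ENNReal.tendsto_ofReal ?_
    have h1 : Tendsto (fun k : ℕ => (u x / (u x + 1 / ((k : ℝ) + 1))) ^ (p - 1)) atTop (𝓝 1) := by
      have h2 : Tendsto (fun k : ℕ => u x / (u x + 1 / ((k : ℝ) + 1))) atTop (𝓝 (u x / (u x + 0))) :=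
        tendsto_const_nhds.div (tendsto_const_nhds.add hε0) (by simpa using hx.ne')
      rw [add_zero, div_self hx.ne'] at h2
      simpa using h2.rpow_const (p := p - 1) (Or.inl one_ne_zero)
    simpa using h1.mul (((hxv.abs).rpow_const (Or.inr hp0.le)).div_const _)
  · have hR : ∀ k : ℕ, Measurable fun z =>
        ENNReal.ofReal (piconeRemainder s p (1 / ((k : ℝ) + 1)) u (φ k) z) := fun k => by
      have := hφm k
      unfold piconeRemainder
      fun_prop
    refine le_trans (le_trans (le_of_eq (lintegral_congr_ae ?_)) (lintegral_liminf_le hR))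
      (liminf_le_liminf (Eventually.of_forall fun k => setLIntegral_le_lintegral _ _))
    -- Positivity of u is known only in Ω, which is why the limiting remainder, with ε = 0, is kept
    -- only on Ω × Ω.
    have hx : ∀ᵐ x ∂(volume.restrict Ω), 0 < u x ∧ Tendsto (fun k => φ k x) atTop (𝓝 (v x)) :=
      hupos.and (ae_restrict_of_ae hae)
    rw [Measure.volume_eq_prod, ← Measure.prod_restrict]
    filter_upwards [Measure.quasiMeasurePreserving_fst.ae hx,
      Measure.quasiMeasurePreserving_snd.ae hx] with z h1 h2
    refine (Tendsto.liminf_eq (ENNReal.tendsto_ofReal ?_)).symm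
    have hq : ∀ x, (0 < u x ∧ Tendsto (fun k => φ k x) atTop (𝓝 (v x))) →
        Tendsto (fun k : ℕ => |φ k x| ^ p / (u x + 1 / ((k : ℝ) + 1)) ^ (p - 1)) atTop
          (𝓝 (|v x| ^ p / (u x + 0) ^ (p - 1))) := by
      intro x hx
      refine ((hx.2.abs).rpow_const (Or.inr hp0.le)).div
        ((tendsto_const_nhds.add hε0).rpow_const (Or.inl ?_)) ?_
      · simpa using hx.1.ne'
      · rw [add_zero]
        exact (Real.rpow_pos_of_pos hx.1 _).ne'
    exact ((((h1.2.abs.sub h2.2.abs).abs).rpow_const (Or.inr hp0.le)).sub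
      (((hq _ h1).sub (hq _ h2)).const_mul _)).div_const _

/-! ### Rigidity of minimizers and conclusion -/

/-- A minimizer is proportional to any positive supersolution. -/
theorem exists_abs_eq_const_mul {N : ℕ} {s p lam : ℝ} (hp : 1 < p) (hs : 0 < s)
    (hlam : 0 ≤ lam) {Ω : Set (EuclideanSpace ℝ (Fin N))} (hN : 0 < N) (hΩ : IsOpen Ω)
    (hne : (frontier Ω).Nonempty) {u v : EuclideanSpace ℝ (Fin N) → ℝ}
    (hu : IsLocalWeakSupersolution s p Ω lam u) (hum : Measurable u) (hu0 : ∀ x, 0 ≤ u x)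
    (hupos : ∀ᵐ x ∂(volume.restrict Ω), 0 < u x) (hv : MemWTildeZero s p Ω v)
    (hv1 : hardyIntegral s p Ω v = 1)
    (hvE : gagliardoEnergy s p univ v = ENNReal.ofReal lam) :
    ∃ c : ℝ, 0 < c ∧ ∀ᵐ x ∂(volume.restrict Ω), |v x| = c * u x := by
  have hp0 : 0 < p := by linarith
  have hmain := hardyIntegral_add_piconeRemainder_le hp hs hlam hΩ hne hu hum hu0 hupos hv
  rw [hv1, mul_one, hvE] at hmain
  have hzero : ∫⁻ z in Ω ×ˢ Ω, ENNReal.ofReal (piconeRemainder s p 0 u v z) = 0 := by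
    have h := ENNReal.le_sub_of_add_le_left ENNReal.ofReal_ne_top hmain
    rwa [tsub_self, nonpos_iff_eq_zero] at h
  have hvL := hv.1.1.1.aemeasurable
  rw [Measure.restrict_univ] at hvL
  have hJ := measurable_Jp p
  have hRm : AEMeasurable (piconeRemainder s p 0 u v) volume := by
    have h1 : AEMeasurable (fun z : EuclideanSpace ℝ (Fin N) × EuclideanSpace ℝ (Fin N) => v z.1)
        volume := hvL.comp_quasiMeasurePreserving Measure.quasiMeasurePreserving_fst
    have h2 : AEMeasurable (fun z : EuclideanSpace ℝ (Fin N) × EuclideanSpace ℝ (Fin N) => v z.2)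
        volume := hvL.comp_quasiMeasurePreserving Measure.quasiMeasurePreserving_snd
    unfold piconeRemainder
    fun_prop
  rw [lintegral_eq_zero_iff' hRm.ennreal_ofReal.restrict, Measure.volume_eq_prod,
    ← Measure.prod_restrict] at hzero
  have hprod := Measure.ae_ae_of_ae_prod hzero
  have hvpos : ∃ᵐ x ∂(volume.restrict Ω), v x ≠ 0 := by
    intro h
    have : hardyIntegral s p Ω v = 0 := by
      rw [hardyIntegral]
      refine (lintegral_congr_ae ?_).trans lintegral_zero
      filter_upwards [h] with x hx
      simp [not_not.1 hx, Real.zero_rpow hp0.ne']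
    simp [hv1] at this
  -- Fix one y with v(y) ≠ 0 and u(y) > 0 such that the remainder vanishes at (y, x) for almost
  -- every x; then c = |v(y)| / u(y).
  obtain ⟨y, hvy, hy, huy⟩ := (hvpos.and_eventually (hprod.and hupos)).exists
  refine ⟨|v y| / u y, div_pos (abs_pos.2 hvy) huy, ?_⟩
  -- In positive dimension points are null, so x = y, where the kernel's denominator is zero, can be
  -- discarded.
  have : Nonempty (Fin N) := ⟨⟨0, hN⟩⟩
  have hxy : ∀ᵐ x ∂(volume.restrict Ω), x ≠ y :=
    ae_restrict_of_ae (compl_mem_ae_iff.2 (measure_singleton y))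
  filter_upwards [hy, hupos, hxy] with x hx hux hne
  simp only [Pi.zero_apply, ENNReal.ofReal_eq_zero] at hx
  have hk : 0 < ‖y - x‖ ^ ((N : ℝ) + s * p) :=
    Real.rpow_pos_of_pos (norm_pos_iff.2 (sub_ne_zero.2 hne.symm)) _
  obtain ⟨h1, h2⟩ := picone hp huy hux (abs_nonneg (v y)) (abs_nonneg (v x))
  rw [piconeRemainder, div_le_iff₀ hk, zero_mul] at hx
  simp only [add_zero] at hx
  have := h2 (le_antisymm h1 (by linarith))
  field_simp
  linarith

end FractionalHardy

theorem mainTheorem3 (n : ℕ) (s p : ℝ) (hp : 1 < p) (hs0 : 0 < s) (hs1 : s < 1)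
    (Ω : Set (EuclideanSpace ℝ (Fin (n + 1)))) (hΩ : IsOpen Ω) (hΩ' : Ω ≠ Set.univ)
    (x₀ : EuclideanSpace ℝ (Fin (n + 1)))
    (hx₀ : FractionalHardy.LocallyContinuousBoundaryAt Ω x₀)
    (u : EuclideanSpace ℝ (Fin (n + 1)) → ℝ)
    (hu : FractionalHardy.IsLocalWeakSupersolution s p Ω
      (FractionalHardy.hardyConst s p Ω).toReal u)
    (hu_nonneg : ∀ᵐ x, 0 ≤ u x)
    (hu_pos : ∀ᵐ x ∂(volume.restrict Ω), 0 < u x)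
    (C : ℝ) (hC : 0 < C)
    (hlow : ∀ᵐ x ∂(volume.restrict Ω),
      C⁻¹ * FractionalHardy.bdryDist Ω x ^ ((s * p - 1) / p) ≤ u x) :
    ¬ FractionalHardy.HardyConstAttained s p Ω := by
  open FractionalHardy in
  rintro ⟨v, hv, hv1, hvE⟩
  have hp0 : 0 < p := by linarith
  have hne : (frontier Ω).Nonempty := ⟨x₀, hx₀.1⟩
  have hum := hu.2.1.1.aemeasurable
  set w : EuclideanSpace ℝ (Fin (n + 1)) → ℝ := fun x => max (hum.mk u x) 0 with hw
  have huw : u =ᵐ[volume] w := by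
    filter_upwards [hum.ae_eq_mk, hu_nonneg] with x h1 h2
    simp only [hw]
    rw [← h1, max_eq_left h2]
  have hwm : Measurable w := hum.measurable_mk.max measurable_const
  have hwpos : ∀ᵐ x ∂(volume.restrict Ω), 0 < w x := by
    filter_upwards [hu_pos, ae_restrict_of_ae huw] with x h1 h2
    rwa [← h2]
  -- Without finiteness `toReal` would turn ⊤ into 0; here the constant equals the energy of v.
  have hfin : hardyConst s p Ω ≠ ⊤ := by
    rw [← hvE]
    exact hv.1.2.ne
  obtain ⟨c, hc, hcv⟩ := exists_abs_eq_const_mul hp hs0 ENNReal.toReal_nonneg n.succ_pos hΩ hne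
    (hu.congr huw) hwm (fun x => le_max_right _ _) hwpos hv hv1
    (by rw [hvE, ENNReal.ofReal_toReal hfin])
  -- From |v| = c u ≥ (c/C) d^((sp-1)/p): the p-th power carries d^(sp-1), and the Hardy weight
  -- leaves 1/d.
  have hlb : ENNReal.ofReal ((c * C⁻¹) ^ p) * ∫⁻ x in Ω, ENNReal.ofReal (bdryDist Ω x)⁻¹ ≤
      hardyIntegral s p Ω v := by
    rw [hardyIntegral, ← lintegral_const_mul' _ _ ENNReal.ofReal_ne_top]
    refine lintegral_mono_ae ?_
    filter_upwards [hcv, hlow, ae_restrict_of_ae huw, ae_restrict_mem hΩ.measurableSet]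
      with x h1 h2 h3 hx
    have hd := bdryDist_pos hΩ hne hx
    rw [← ENNReal.ofReal_mul (by positivity)]
    refine ENNReal.ofReal_le_ofReal ?_
    rw [h1, ← h3, le_div_iff₀ (Real.rpow_pos_of_pos hd _)]
    calc _ = (c * (C⁻¹ * bdryDist Ω x ^ ((s * p - 1) / p))) ^ p := by
          rw [← mul_assoc, Real.mul_rpow (x := c * C⁻¹) (by positivity) (by positivity),
            ← Real.rpow_mul hd.le,
            div_mul_cancel₀ _ hp0.ne', Real.rpow_sub hd, Real.rpow_one]
          ring
      _ ≤ _ := by gcongr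
  rw [lintegral_inv_bdryDist_eq_top hΩ hx₀, hv1, ENNReal.mul_top] at hlb
  · exact ENNReal.one_ne_top (top_le_iff.1 hlb)
  · simpa using Real.rpow_pos_of_pos (by positivity) p
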